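/- Let $p\in(0,1)$, let $F$ be the cdf of a probability distribution on $\mathbb{R}$, let $F^{-1}(u)=\inf\{x\in\mathbb{R}: F(x)\ge u\}$ be its quantile function, and put $x_p=F^{-1}(p)$. Assume that $\int_p^1 F^{-1}(u)\,\mathrm{d}u$ is finite (equivalently, $\mathbb{E}(X^+)<\infty$ for $X\sim F$), that $F$ is continuous at $x_p$, and that $F$ is strictly increasing at $x_p$, i.e. $F(y)<F(x_p)<F(z)$ whenever $y<x_p<z$. Let $X_1,X_2,\dots$ be independent random variables with cdf $F$, let $F_n(x)=\frac1n\sum_{i=1}^n \mathbf{1}\{X_i\le x\}$ be the empirical cdf of $X_1,\dots,X_n$, and let $F_n^{-1}(u)=\inf\{x\in\mathbb{R}: F_n(x)\ge u\}$. Suppose that the variance $\sigma_{F,p}^2$ of the random variable $$\int_{x_p}^{\infty}\big(\mathbf{1}\{X\le x\}-F(x)\big)\,\mathrm{d}x,\qquad X\sim F,$$ is finite. Then, as $n\to\infty$, $$\sqrt{n}\left(\int_p^1 F_n^{-1}(u)\,\mathrm{d}u-\int_p^1 F^{-1}(u)\,\mathrm{d}u\right)\to_d \mathcal{N}\big(0,\sigma_{F,p}^2\big).$$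 No density of $F$ is assumed to exist. -/

import Mathlib

open MeasureTheory ProbabilityTheory Filter Set

/-- The quantile function (generalized inverse) `F⁻¹(u) = inf {x : ℝ | F x ≥ u}`. -/
noncomputable def quantile (F : ℝ → ℝ) (u : ℝ) : ℝ :=
  sInf {x : ℝ | F x ≥ u}

/-- The empirical cdf `F_n(x) = n⁻¹ ∑ 1{X_i ≤ x}` of the first `n` members of the sequence `X`,
at the sample point `ω`. -/
noncomputable def empiricalCDF {Ω : Type*} (X : ℕ → Ω → ℝ) (n : ℕ) (ω : Ω) (x : ℝ) : ℝ :=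
  (n : ℝ)⁻¹ * ∑ i ∈ Finset.range n, (Iic x).indicator (fun _ ↦ (1 : ℝ)) (X i ω)

/-- `F` is strictly increasing at the point `x`: it is strictly smaller than `F x` to the left of
`x`, and strictly larger than `F x` to the right of `x`. (For a monotone `F`, it makes no
difference whether this is asked of all points or only of those near `x`.) -/
def StrictlyIncreasingAt (F : ℝ → ℝ) (x : ℝ) : Prop :=
  (∀ y < x, F y < F x) ∧ ∀ y > x, F x < F y

/-- The function `t ↦ ∫_{F⁻¹(p)}^∞ (1{t ≤ x} - F(x)) dx`. -/
noncomputable def tailDeviation (F : ℝ → ℝ) (p t : ℝ) : ℝ :=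
  ∫ x in Ioi (quantile F p), ((Iic x).indicator (fun _ ↦ (1 : ℝ)) t - F x)

open scoped Topology ENNReal

/-! ### Quantile transform and the Rockafellar–Uryasev formula -/

section Quantile

variable {ν : Measure ℝ}

/-! Write `c` for the true `p`-quantile. The tail integral of any quantile function is `(1 - p) * c`
plus the mean of `(x - c)⁺`, up to an error at most |own `p`-quantile − `c`| · |own cdf at `c` −
`p`| (`abs_integral_quantile_sub_le`). The error vanishes for the true law. For the empirical law, a
probability measure to which the same bound applies, the error times √n is a product of two factors.
Since `F c = p` by continuity, one is √n |F_n(c) − F(c)|, tight by Chebyshev; the other is the error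
of the sample quantile, which tends to zero almost surely because `F` increases strictly at `c`. The
product tends to zero in probability, with no density needed. What remains is the normalized centred
sum of `(X_i - c)⁺`, handled by the central limit theorem. By `tailDeviation_cdf_eq` its summands
have the variance in the statement. -/

/-- Galois connection between the cdf and the quantile function. -/
lemma quantile_cdf_le_iff {u : ℝ} (hu : u ∈ Ioo (0 : ℝ) 1) (x : ℝ) :
    quantile (cdf ν) u ≤ x ↔ u ≤ cdf ν x := by
  have hne : {x : ℝ | cdf ν x ≥ u}.Nonempty := by
    obtain ⟨y, hy⟩ := ((tendsto_cdf_atTop ν).eventually (eventually_gt_nhds hu.2)).exists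
    exact ⟨y, hy.le⟩
  have hbdd : BddBelow {x : ℝ | cdf ν x ≥ u} := by
    obtain ⟨y, hy⟩ := ((tendsto_cdf_atBot ν).eventually (eventually_lt_nhds hu.1)).exists
    exact ⟨y, fun z hz ↦ le_of_not_gt fun h ↦ (hz.trans (monotone_cdf ν h.le)).not_gt hy⟩
  refine ⟨fun h ↦ ?_, fun h ↦ csInf_le hbdd h⟩
  refine le_trans ?_ (monotone_cdf ν h)
  -- The infimum is attained by right continuity: every point to its right has cdf at least `u`.
  have hlim : Tendsto (cdf ν) (𝓝[>] (quantile (cdf ν) u)) (𝓝 (cdf ν (quantile (cdf ν) u))) :=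
    ((cdf ν).right_continuous _).mono_left (nhdsWithin_mono _ Ioi_subset_Ici_self)
  refine ge_of_tendsto hlim ?_
  filter_upwards [self_mem_nhdsWithin] with y hy
  obtain ⟨z, hz, hzy⟩ := exists_lt_of_csInf_lt hne hy
  exact le_trans hz (monotone_cdf ν hzy.le)

lemma lt_quantile_cdf_iff {u : ℝ} (hu : u ∈ Ioo (0 : ℝ) 1) (x : ℝ) :
    x < quantile (cdf ν) u ↔ cdf ν x < u := by
  rw [← not_le, quantile_cdf_le_iff hu, not_le]

lemma monotoneOn_quantile_cdf : MonotoneOn (quantile (cdf ν)) (Ioo 0 1) := fun _ ha _ hb hab ↦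
  (quantile_cdf_le_iff ha _).2 (hab.trans ((quantile_cdf_le_iff hb _).1 le_rfl))

lemma aemeasurable_quantile_cdf :
    AEMeasurable (quantile (cdf ν)) (volume.restrict (Ioo 0 1)) :=
  aemeasurable_restrict_of_monotoneOn measurableSet_Ioo monotoneOn_quantile_cdf

/-- The difference between the positive part of `F⁻¹ - c` and the upper tail of `F⁻¹ - c` is
supported between `p` and `F c`, and bounded by `|F⁻¹ p - c|`. -/
lemma abs_posPart_sub_indicator_quantile_le {p : ℝ} (hp : p ∈ Ioo (0 : ℝ) 1) (c : ℝ) {u : ℝ}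
    (hu : u ∈ Ioo (0 : ℝ) 1) :
    |max (quantile (cdf ν) u - c) 0 - (Ioi p).indicator (fun u ↦ quantile (cdf ν) u - c) u| ≤
      (uIoc p (cdf ν c)).indicator (fun _ ↦ |quantile (cdf ν) p - c|) u := by
  by_cases hpu : p < u
  · rw [indicator_of_mem (mem_Ioi.2 hpu)]
    have hmono := monotoneOn_quantile_cdf (ν := ν) hp hu hpu.le
    by_cases hc : quantile (cdf ν) u ≤ c
    · have : u ∈ uIoc p (cdf ν c) :=
        mem_uIoc.2 (Or.inl ⟨hpu, (quantile_cdf_le_iff hu c).1 hc⟩)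
      rw [indicator_of_mem this, max_eq_right (by linarith), abs_of_nonneg (by linarith),
        abs_of_nonpos (by linarith)]
      linarith
    · rw [max_eq_left (by linarith), sub_self, abs_zero]
      exact indicator_nonneg (fun _ _ ↦ abs_nonneg _) _
  · rw [indicator_of_notMem (by simpa using hpu), sub_zero]
    have hmono := monotoneOn_quantile_cdf (ν := ν) hu hp (not_lt.1 hpu)
    by_cases hc : quantile (cdf ν) u ≤ c
    · rw [max_eq_right (by linarith), abs_zero]
      exact indicator_nonneg (fun _ _ ↦ abs_nonneg _) _
    · have : u ∈ uIoc p (cdf ν c) :=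
        mem_uIoc.2 (Or.inr ⟨(lt_quantile_cdf_iff hu c).1 (not_le.1 hc), not_lt.1 hpu⟩)
      rw [indicator_of_mem this, max_eq_left (by linarith), abs_of_nonneg (by linarith),
        abs_of_nonneg (by linarith)]
      linarith

/-- At a continuity point, the cdf takes the value `p` at the `p`-quantile. -/
lemma cdf_quantile_eq {p : ℝ} (hp : p ∈ Ioo (0 : ℝ) 1)
    (hcont : ContinuousAt (cdf ν) (quantile (cdf ν) p)) :
    cdf ν (quantile (cdf ν) p) = p := by
  refine le_antisymm ?_ ((quantile_cdf_le_iff hp _).1 le_rfl)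
  refine le_of_tendsto (hcont.tendsto.mono_left nhdsWithin_le_nhds :
    Tendsto (cdf ν) (𝓝[<] (quantile (cdf ν) p)) _) ?_
  filter_upwards [self_mem_nhdsWithin] with y hy
  exact ((lt_quantile_cdf_iff hp y).1 hy).le

variable [IsProbabilityMeasure ν]

/-- The quantile transform: the quantile function of a uniform random variable has law `ν`. -/
lemma map_quantile_cdf : (volume.restrict (Ioo (0 : ℝ) 1)).map (quantile (cdf ν)) = ν := by
  have : IsFiniteMeasure ((volume.restrict (Ioo (0 : ℝ) 1)).map (quantile (cdf ν))) :=
    Measure.isFiniteMeasure_map _ _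
  refine Measure.ext_of_Iic _ _ fun x ↦ ?_
  rw [Measure.map_apply_of_aemeasurable aemeasurable_quantile_cdf measurableSet_Iic,
    Measure.restrict_apply₀' measurableSet_Ioo.nullMeasurableSet, ← ofReal_cdf]
  have hset : quantile (cdf ν) ⁻¹' Iic x ∩ Ioo 0 1 = Iic (cdf ν x) ∩ Ioo 0 1 := by
    ext u
    simp only [mem_inter_iff, mem_preimage, mem_Iic, and_congr_left_iff]
    exact fun hu ↦ quantile_cdf_le_iff hu x
  -- The endpoint 1 is null, and half-open intervals stay half-open when cut by `Iic`.
  have hae : (Iic (cdf ν x) ∩ Ioo 0 1 : Set ℝ) =ᵐ[volume] (Iic (cdf ν x) ∩ Ioc 0 1 : Set ℝ) :=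
    (ae_eq_refl _).inter Ioo_ae_eq_Ioc
  rw [hset, measure_congr hae, inter_comm, Ioc_inter_Iic, min_eq_right (cdf_le_one ν x),
    Real.volume_Ioc, sub_zero]

lemma integrableOn_comp_quantile_cdf_iff {f : ℝ → ℝ} (hf : Continuous f) :
    IntegrableOn (fun u ↦ f (quantile (cdf ν) u)) (Ioo 0 1) ↔ Integrable f ν := by
  conv_rhs => rw [← map_quantile_cdf (ν := ν)]
  exact (integrable_map_measure hf.aestronglyMeasurable aemeasurable_quantile_cdf).symm

lemma setIntegral_comp_quantile_cdf {f : ℝ → ℝ} (hf : Continuous f) :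
    ∫ u in Ioo 0 1, f (quantile (cdf ν) u) = ∫ x, f x ∂ν := by
  conv_rhs => rw [← map_quantile_cdf (ν := ν)]
  exact (integral_map aemeasurable_quantile_cdf hf.aestronglyMeasurable).symm

/-- If the upper tail of the quantile function is integrable, then so is the positive part of
the distribution, centred at the quantile. -/
lemma integrable_posPart_sub_quantile {p : ℝ} (hp : p ∈ Ioo (0 : ℝ) 1)
    (hF : IntervalIntegrable (quantile (cdf ν)) volume p 1) :
    Integrable (fun x ↦ max (x - quantile (cdf ν) p) 0) ν := by
  rw [← integrableOn_comp_quantile_cdf_iff (by fun_prop)]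
  rw [intervalIntegrable_iff_integrableOn_Ioo_of_le hp.2.le] at hF
  have h : IntegrableOn (fun u ↦ quantile (cdf ν) u - quantile (cdf ν) p) (Ioo p 1) :=
    hF.sub (integrableOn_const (by simp))
  refine ((integrable_indicator_iff measurableSet_Ioo).2 h).integrableOn.congr_fun
    (s := Ioo 0 1) (fun u hu ↦ ?_) measurableSet_Ioo
  by_cases hpu : p < u
  · rw [indicator_of_mem (show u ∈ Ioo p 1 from ⟨hpu, hu.2⟩), max_eq_left]
    exact sub_nonneg.2 (monotoneOn_quantile_cdf hp hu hpu.le)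
  · rw [indicator_of_notMem (fun h ↦ hpu h.1), max_eq_right]
    exact sub_nonpos.2 (monotoneOn_quantile_cdf hu hp (not_lt.1 hpu))

/-- Approximate Rockafellar–Uryasev formula for the integral of the upper tail of the quantile
function. It is exact when `c` is the `p`-quantile. -/
lemma abs_integral_quantile_sub_le {p : ℝ} (hp : p ∈ Ioo (0 : ℝ) 1) (c : ℝ)
    (hint : Integrable (fun x ↦ max (x - c) 0) ν) :
    |(∫ u in p..1, quantile (cdf ν) u) - ((1 - p) * c + ∫ x, max (x - c) 0 ∂ν)| ≤
      |quantile (cdf ν) p - c| * |cdf ν c - p| := by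
  set Q := quantile (cdf ν) with hQ
  let g : ℝ → ℝ := fun u ↦ max (Q u - c) 0
  let t : ℝ → ℝ := (Ioi p).indicator fun u ↦ Q u - c
  have hcont : Continuous fun x : ℝ ↦ max (x - c) 0 := by fun_prop
  have hg : IntegrableOn g (Ioo 0 1) := (integrableOn_comp_quantile_cdf_iff hcont).2 hint
  have hgt : ∫ u in Ioo 0 1, g u = ∫ x, max (x - c) 0 ∂ν := setIntegral_comp_quantile_cdf hcont
  have hbound : Integrable ((uIoc p (cdf ν c)).indicator fun _ ↦ |Q p - c|) :=
    (integrable_indicator_iff measurableSet_uIoc).2 (integrableOn_const (by simp [uIoc]))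
  have htm : AEStronglyMeasurable t (volume.restrict (Ioo 0 1)) :=
    ((aemeasurable_quantile_cdf.sub_const c).indicator measurableSet_Ioi).aestronglyMeasurable
  have hle : ∀ᵐ u ∂volume.restrict (Ioo 0 1), ‖g u - t u‖ ≤
      (uIoc p (cdf ν c)).indicator (fun _ ↦ |Q p - c|) u :=
    (ae_restrict_mem measurableSet_Ioo).mono fun u hu ↦
      abs_posPart_sub_indicator_quantile_le hp c hu
  -- Integrability of the quantile tail is not assumed: `t` differs from the integrable `g` by a
  -- dominated function.
  have hgt' : IntegrableOn (fun u ↦ g u - t u) (Ioo 0 1) :=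
    Integrable.mono' hbound.integrableOn (hg.1.sub htm) hle
  have ht : IntegrableOn t (Ioo 0 1) := by
    exact (hg.sub hgt').congr (ae_of_all _ fun u ↦ sub_sub_cancel (g u) (t u))
  have hinter : Ioo (0 : ℝ) 1 ∩ Ioi p = Ioo p 1 := by
    rw [inter_comm, Ioi_inter_Ioo, max_eq_left hp.1.le]
  have hQc : IntegrableOn (fun u ↦ Q u - c) (Ioo p 1) := by
    have := (integrable_indicator_iff measurableSet_Ioi).1 ht
    rwa [IntegrableOn, Measure.restrict_restrict measurableSet_Ioi, inter_comm, hinter] at this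
  have hQint : IntegrableOn Q (Ioo p 1) := by
    exact (hQc.add (integrableOn_const (C := c) (by simp))).congr
      (ae_of_all _ fun u ↦ sub_add_cancel (Q u) c)
  have hvalue : ∫ u in Ioo 0 1, t u = (∫ u in p..1, Q u) - (1 - p) * c := by
    rw [setIntegral_indicator measurableSet_Ioi, hinter,
      integral_sub hQint (integrableOn_const (by simp)), setIntegral_const,
      intervalIntegral.integral_of_le hp.2.le, integral_Ioc_eq_integral_Ioo]
    simp [hp.2.le]
  have hkey : |∫ u in Ioo 0 1, (g u - t u)| ≤ |Q p - c| * |cdf ν c - p| := by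
    calc |∫ u in Ioo 0 1, (g u - t u)|
        ≤ ∫ u in Ioo 0 1, (uIoc p (cdf ν c)).indicator (fun _ ↦ |Q p - c|) u :=
          norm_integral_le_of_norm_le hbound.integrableOn hle
      _ ≤ ∫ u, (uIoc p (cdf ν c)).indicator (fun _ ↦ |Q p - c|) u :=
          setIntegral_le_integral hbound
            (ae_of_all _ fun u ↦ indicator_nonneg (fun _ _ ↦ abs_nonneg _) u)
      _ = |Q p - c| * |cdf ν c - p| := by
          rw [integral_indicator measurableSet_uIoc, setIntegral_const, measureReal_def,
            Real.volume_uIoc, ENNReal.toReal_ofReal (abs_nonneg _), smul_eq_mul, mul_comm]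
  rw [integral_sub hg ht, hgt, hvalue] at hkey
  rw [abs_sub_comm]
  convert hkey using 2
  ring

lemma integral_quantile_eq {p : ℝ} (hp : p ∈ Ioo (0 : ℝ) 1)
    (hF : IntervalIntegrable (quantile (cdf ν)) volume p 1) :
    ∫ u in p..1, quantile (cdf ν) u = (1 - p) * quantile (cdf ν) p +
      ∫ x, max (x - quantile (cdf ν) p) 0 ∂ν := by
  have := abs_integral_quantile_sub_le hp _ (integrable_posPart_sub_quantile hp hF)
  rw [sub_self, abs_zero, zero_mul] at this
  exact sub_eq_zero.1 (abs_eq_zero.1 (this.antisymm (abs_nonneg _)))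

/-- The survival function is integrable on a half-line whenever the positive part is. -/
lemma integrableOn_one_sub_cdf {c : ℝ} (hint : Integrable (fun x ↦ max (x - c) 0) ν) :
    IntegrableOn (fun x ↦ 1 - cdf ν x) (Ioi c) := by
  -- Layer-cake formula for the mean of the positive part.
  have hlt : ∫⁻ t in Ioi 0, ν {a | t < max (a - c) 0} ≠ ⊤ := by
    rw [← lintegral_eq_lintegral_meas_lt (f := fun x ↦ max (x - c) 0) ν (ae_of_all _ fun x ↦ le_max_right _ _)
      hint.aemeasurable]
    exact hint.lintegral_lt_top.ne
  have hmeas : Measurable fun t : ℝ ↦ ν {a | t < max (a - c) 0} :=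
    Antitone.measurable fun _ _ hst ↦ measure_mono fun _ h ↦ lt_of_le_of_lt hst h
  have h1 : IntegrableOn (fun t ↦ 1 - cdf ν (t + c)) (Ioi 0) := by
    refine IntegrableOn.congr_fun (f := fun t ↦ (ν {a | t < max (a - c) 0}).toReal)
      (integrable_toReal_of_lintegral_ne_top hmeas.aemeasurable hlt) (fun t ht ↦ ?_)
      measurableSet_Ioi
    have hset : {a | t < max (a - c) 0} = (Iic (t + c))ᶜ := by
      ext a
      have : ¬ t < 0 := (mem_Ioi.1 ht).le.not_gt
      simp [this, lt_sub_iff_add_lt]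
    simp only [hset, cdf_eq_real]
    exact probReal_compl_eq_one_sub measurableSet_Iic
  have h2 := (measurePreserving_add_right volume c).integrableOn_comp_preimage
    (measurableEmbedding_addRight c) (f := fun x ↦ 1 - cdf ν x) (s := Ioi c)
  rw [← h2]
  simpa [Function.comp_def] using! h1

/-- The tail deviation is a constant minus the positive part of `t - F⁻¹ p`. -/
lemma tailDeviation_cdf_eq {p : ℝ}
    (hint : Integrable (fun x ↦ max (x - quantile (cdf ν) p) 0) ν) (t : ℝ) :
    tailDeviation (cdf ν) p t = (∫ x in Ioi (quantile (cdf ν) p), (1 - cdf ν x)) -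
      max (t - quantile (cdf ν) p) 0 := by
  set c := quantile (cdf ν) p with hc
  -- Neither the indicator nor `F` is integrable at infinity; subtracting each from 1 makes both
  -- pieces integrable.
  have heq : ∀ x, (Iic x).indicator (fun _ ↦ (1 : ℝ)) t - cdf ν x =
      (1 - cdf ν x) - (Iio t).indicator (fun _ ↦ (1 : ℝ)) x := by
    intro x
    by_cases h : t ≤ x
    · rw [indicator_of_mem (mem_Iic.2 h), indicator_of_notMem (by simpa using h), sub_zero]
    · rw [indicator_of_notMem (by simpa using h), indicator_of_mem (by simpa using h)]
      ring
  have hset : Ioi c ∩ Iio t = Ioo c t := rfl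
  have hi : IntegrableOn ((Iio t).indicator fun _ ↦ (1 : ℝ)) (Ioi c) := by
    rw [IntegrableOn, integrable_indicator_iff measurableSet_Iio, IntegrableOn,
      Measure.restrict_restrict measurableSet_Iio, inter_comm, hset]
    exact integrableOn_const (by simp)
  simp_rw [tailDeviation, ← hc, heq]
  rw [integral_sub (integrableOn_one_sub_cdf hint) hi, setIntegral_indicator measurableSet_Iio,
    hset, setIntegral_const, smul_eq_mul, mul_one, Real.volume_real_Ioo]

end Quantile

/-! ### The empirical law and measurability of its quantiles -/

section EmpiricalMeasure

variable {Ω : Type*}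

/-- The empirical measure of the first `n` members of the sequence `X`. -/
noncomputable def empiricalMeasure (X : ℕ → Ω → ℝ) (n : ℕ) (ω : Ω) : Measure ℝ :=
  (n : ℝ≥0∞)⁻¹ • ∑ i ∈ Finset.range n, Measure.dirac (X i ω)

variable (X : ℕ → Ω → ℝ) {n : ℕ} (hn : n ≠ 0) (ω : Ω)

include hn in
lemma isProbabilityMeasure_empiricalMeasure : IsProbabilityMeasure (empiricalMeasure X n ω) := by
  constructor
  simp [empiricalMeasure, ENNReal.inv_mul_cancel, hn]

lemma integrable_empiricalMeasure (f : ℝ → ℝ) : Integrable f (empiricalMeasure X n ω) := by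
  obtain rfl | hn := eq_or_ne n 0
  · simp [empiricalMeasure]
  · exact (integrable_finsetSum_measure.2 fun i _ ↦ integrable_dirac (by simp)).smul_measure
      (by simp [hn])

lemma integral_empiricalMeasure (f : ℝ → ℝ) :
    ∫ x, f x ∂empiricalMeasure X n ω = (n : ℝ)⁻¹ * ∑ i ∈ Finset.range n, f (X i ω) := by
  rw [empiricalMeasure, integral_smul_measure,
    integral_finsetSum_measure fun i _ ↦ integrable_dirac (by simp)]
  simp

include hn in
-- This transfers every deterministic result on quantiles of a law to the sample.
lemma cdf_empiricalMeasure : ⇑(cdf (empiricalMeasure X n ω)) = empiricalCDF X n ω := by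
  have := isProbabilityMeasure_empiricalMeasure X hn ω
  ext x
  rw [cdf_eq_real, ← integral_indicator_one measurableSet_Iic]
  exact integral_empiricalMeasure X ω _

include hn in
lemma quantile_empiricalCDF_le_iff {u : ℝ} (hu : u ∈ Ioo (0 : ℝ) 1) (x : ℝ) :
    quantile (empiricalCDF X n ω) u ≤ x ↔ u ≤ empiricalCDF X n ω x := by
  rw [← cdf_empiricalMeasure X hn ω]
  exact quantile_cdf_le_iff hu x

include hn in
lemma abs_integral_quantile_empiricalCDF_sub_le {p : ℝ} (hp : p ∈ Ioo (0 : ℝ) 1) (c : ℝ) :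
    |(∫ u in p..1, quantile (empiricalCDF X n ω) u) -
        ((1 - p) * c + (n : ℝ)⁻¹ * ∑ i ∈ Finset.range n, max (X i ω - c) 0)| ≤
      |quantile (empiricalCDF X n ω) p - c| * |empiricalCDF X n ω c - p| := by
  have := isProbabilityMeasure_empiricalMeasure X hn ω
  have h := abs_integral_quantile_sub_le (ν := empiricalMeasure X n ω) hp c
    (integrable_empiricalMeasure X ω _)
  rwa [cdf_empiricalMeasure X hn ω, integral_empiricalMeasure] at h

variable [MeasurableSpace Ω] {P : Measure Ω}

lemma measurable_empiricalCDF {X : ℕ → Ω → ℝ} (hX : ∀ i, Measurable (X i)) (x : ℝ) :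
    Measurable fun ω ↦ empiricalCDF X n ω x :=
  (Finset.measurable_fun_sum _ fun i _ ↦
    (measurable_const.indicator measurableSet_Iic).comp (hX i)).const_mul _

lemma measurable_quantile_empiricalCDF {X : ℕ → Ω → ℝ} (hX : ∀ i, Measurable (X i)) :
    Measurable fun q : Ω × Ioo (0 : ℝ) 1 ↦ quantile (empiricalCDF X n q.1) q.2 := by
  obtain rfl | hn := eq_or_ne n 0
  -- For `n = 0` the empirical cdf is 0, so the infimum is over the empty set and equals 0 by
  -- convention.
  · have : ∀ q : Ω × Ioo (0 : ℝ) 1, quantile (empiricalCDF X 0 q.1) q.2 = 0 := fun q ↦ by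
      simp [quantile, empiricalCDF, q.2.2.1.not_ge]
    simp_rw [this]
    exact measurable_const
  refine measurable_of_Iic fun x ↦ ?_
  have : (fun q : Ω × Ioo (0 : ℝ) 1 ↦ quantile (empiricalCDF X n q.1) q.2) ⁻¹' Iic x =
      {q | (q.2 : ℝ) ≤ empiricalCDF X n q.1 x} := by
    ext q
    exact quantile_empiricalCDF_le_iff X hn q.1 q.2.2 x
  rw [this]
  exact measurableSet_le (by fun_prop) ((measurable_empiricalCDF hX x).comp measurable_fst)

/-- The `X i` are only a.e. measurable, so measurability is shown for the coordinates on `ℕ → ℝ` and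
pulled back. -/
lemma aemeasurable_quantile_empiricalCDF {X : ℕ → Ω → ℝ} (hX : ∀ i, AEMeasurable (X i) P)
    {p : ℝ} (hp : p ∈ Ioo (0 : ℝ) 1) :
    AEMeasurable (fun ω ↦ quantile (empiricalCDF X n ω) p) P := by
  have h := (measurable_quantile_empiricalCDF (n := n) (X := fun i (x : ℕ → ℝ) ↦ x i)
    fun i ↦ measurable_pi_apply i).comp
      (measurable_id.prodMk (measurable_const (a := (⟨p, hp⟩ : Ioo (0 : ℝ) 1))))
  exact h.comp_aemeasurable (aemeasurable_pi_lambda (fun ω i ↦ X i ω) hX)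

lemma aemeasurable_integral_quantile_empiricalCDF {X : ℕ → Ω → ℝ}
    (hX : ∀ i, AEMeasurable (X i) P) {p : ℝ} (hp : p ∈ Ioo (0 : ℝ) 1) :
    AEMeasurable (fun ω ↦ ∫ u in p..1, quantile (empiricalCDF X n ω) u) P := by
  have h : Measurable fun x : ℕ → ℝ ↦
      ∫ u in p..1, quantile (empiricalCDF (fun i (x : ℕ → ℝ) ↦ x i) n x) u := by
    simp_rw [intervalIntegral.integral_of_le hp.2.le, integral_Ioc_eq_integral_Ioo]
    simp_rw [← integral_subtype_comap measurableSet_Ioo]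
    have hsub : Ioo p 1 ⊆ Ioo (0 : ℝ) 1 := Ioo_subset_Ioo_left hp.1.le
    have hj := (measurable_quantile_empiricalCDF (n := n) (X := fun i (x : ℕ → ℝ) ↦ x i)
      fun i ↦ measurable_pi_apply i).comp
        (measurable_id.prodMap (measurable_inclusion hsub))
    have : IsFiniteMeasure ((volume : Measure ℝ).comap ((↑) : Ioo p 1 → ℝ)) := by
      refine ⟨?_⟩
      rw [comap_subtype_coe_apply measurableSet_Ioo, image_univ, Subtype.range_coe]
      exact measure_Ioo_lt_top
    exact hj.stronglyMeasurable.integral_prod_right'.measurable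
  exact h.comp_aemeasurable (aemeasurable_pi_lambda (fun ω i ↦ X i ω) hX)

end EmpiricalMeasure

/-! ### Tightness and consistency -/

section Probability

variable {Ω : Type*} [MeasurableSpace Ω] {P : Measure Ω}

/-- A sequence dominated by the product of a tight sequence and a sequence that tends to zero in
probability tends to zero in probability. -/
lemma tendstoInMeasure_zero_of_abs_le_mul {A B D : ℕ → Ω → ℝ}
    (hA : ∀ η : ℝ≥0∞, 0 < η → ∃ M : ℝ, 0 < M ∧ ∀ n, P {ω | M ≤ |A n ω|} ≤ η)
    (hB : TendstoInMeasure P B atTop 0) (hD : ∀ n ω, |D n ω| ≤ |A n ω| * |B n ω|) :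
    TendstoInMeasure P D atTop 0 := by
  rw [tendstoInMeasure_iff_norm] at hB ⊢
  intro ε hε
  rw [ENNReal.tendsto_nhds_zero]
  intro η hη
  obtain ⟨M, hM, hAM⟩ := hA (η / 2) (ENNReal.half_pos hη.ne')
  filter_upwards [ENNReal.tendsto_nhds_zero.1 (hB (ε / M) (by positivity)) (η / 2)
    (ENNReal.half_pos hη.ne')] with n hn
  -- Off both events the product is below `M * (ε / M) = ε`.
  have hsub : {ω | ε ≤ ‖D n ω - (0 : Ω → ℝ) ω‖} ⊆
      {ω | M ≤ |A n ω|} ∪ {ω | ε / M ≤ ‖B n ω - (0 : Ω → ℝ) ω‖} := by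
    intro ω hω
    by_contra hcon
    simp only [mem_union, mem_ofPred_eq, not_or, not_le, Pi.zero_apply, sub_zero,
      Real.norm_eq_abs] at hcon hω
    have h2 := (lt_div_iff₀ hM).1 hcon.2
    nlinarith [hD n ω, abs_nonneg (A n ω), abs_nonneg (B n ω), hcon.1]
  calc _ ≤ P _ := measure_mono hsub
    _ ≤ _ := measure_union_le _ _
    _ ≤ η / 2 + η / 2 := add_le_add (hAM n) hn
    _ = η := ENNReal.add_halves η

variable {μ : Measure ℝ} {X : ℕ → Ω → ℝ}

lemma identDistrib_of_hasLaw (hlaw : ∀ i, HasLaw (X i) μ P) (i j : ℕ) :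
    IdentDistrib (X i) (X j) P P :=
  ⟨(hlaw i).aemeasurable, (hlaw j).aemeasurable, (hlaw i).map_eq.trans (hlaw j).map_eq.symm⟩

lemma measurable_indicator_Iic_one (x : ℝ) :
    Measurable ((Iic x).indicator fun _ ↦ (1 : ℝ)) :=
  measurable_const.indicator measurableSet_Iic

lemma integral_indicator_Iic_comp [IsProbabilityMeasure μ] (hlaw : ∀ i, HasLaw (X i) μ P) (x : ℝ) (i : ℕ) :
    ∫ ω, (Iic x).indicator (fun _ ↦ (1 : ℝ)) (X i ω) ∂P = cdf μ x := by
  rw [cdf_eq_real, ← integral_indicator_one measurableSet_Iic]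
  exact (hlaw i).integral_comp (f := (Iic x).indicator fun _ ↦ (1 : ℝ))
    (measurable_indicator_Iic_one x).aestronglyMeasurable

variable [IsProbabilityMeasure P]

lemma memLp_indicator_Iic_comp (hlaw : ∀ i, HasLaw (X i) μ P) (x : ℝ) (i : ℕ) (q : ℝ≥0∞) :
    MemLp (fun ω ↦ (Iic x).indicator (fun _ ↦ (1 : ℝ)) (X i ω)) q P := by
  refine MemLp.of_bound ((measurable_indicator_Iic_one x).comp_aemeasurable
    (hlaw i).aemeasurable).aestronglyMeasurable 1 (ae_of_all _ fun ω ↦ ?_)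
  simp only [indicator_apply]
  split_ifs <;> simp

variable [IsProbabilityMeasure μ]

/-- Chebyshev bound for the empirical cdf. -/
lemma measure_sqrt_mul_empiricalCDF_sub_le (hindep : iIndepFun X P)
    (hlaw : ∀ i, HasLaw (X i) μ P) (x : ℝ) (n : ℕ) {M : ℝ} (hM : 0 < M) :
    P {ω | M ≤ |√(n : ℝ) * (empiricalCDF X n ω x - cdf μ x)|} ≤ ENNReal.ofReal (1 / M ^ 2) := by
  obtain rfl | hn := eq_or_ne n 0
  · simp [hM.not_ge]
  let Z : ℕ → Ω → ℝ := fun i ω ↦ (Iic x).indicator (fun _ ↦ (1 : ℝ)) (X i ω)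
  have hZ : ∀ i, MemLp (Z i) 2 P := fun i ↦ memLp_indicator_Iic_comp hlaw x i 2
  have hZindep : iIndepFun Z P := hindep.comp _ fun _ ↦ measurable_indicator_Iic_one x
  have hn0 : (0 : ℝ) < n := by positivity
  let S : Ω → ℝ := fun ω ↦ (√(n : ℝ))⁻¹ * (∑ i ∈ Finset.range n, Z i) ω
  have hS : MemLp S 2 P := (memLp_finsetSum' _ fun i _ ↦ hZ i).const_mul _
  have hSint : ∫ ω, S ω ∂P = √(n : ℝ) * cdf μ x := by
    simp only [S, Finset.sum_apply]
    rw [integral_const_mul, integral_finsetSum _ fun i _ ↦ (hZ i).integrable (by norm_num)]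
    simp only [Z, integral_indicator_Iic_comp hlaw, Finset.sum_const, Finset.card_range,
      nsmul_eq_mul]
    rw [← mul_assoc]
    congr 1
    field_simp
    exact (Real.sq_sqrt hn0.le).symm
  have hSvar : Var[S; P] ≤ 1 := by
    simp only [S]
    rw [variance_const_mul, IndepFun.variance_sum (fun i _ ↦ hZ i)
      fun i _ j _ hij ↦ hZindep.indepFun hij, inv_pow, Real.sq_sqrt hn0.le,
      inv_mul_le_iff₀ hn0, mul_one]
    calc ∑ i ∈ Finset.range n, Var[Z i; P] ≤ ∑ i ∈ Finset.range n, 1 := by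
          refine Finset.sum_le_sum fun i _ ↦ ?_
          refine (variance_le_sq_of_bounded (a := 0) (b := 1) (ae_of_all _ fun ω ↦ ?_)
            (hZ i).aemeasurable).trans (by norm_num)
          simp only [Z, indicator_apply]
          split_ifs <;> simp
      _ = n := by simp
  have hset : ∀ ω, √(n : ℝ) * (empiricalCDF X n ω x - cdf μ x) = S ω - ∫ ω, S ω ∂P := by
    intro ω
    rw [hSint, mul_sub, empiricalCDF, ← mul_assoc]
    simp only [S, Z, Finset.sum_apply]
    congr 2
    field_simp
    exact Real.sq_sqrt hn0.le
  simp_rw [hset]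
  refine (meas_ge_le_variance_div_sq hS hM).trans (ENNReal.ofReal_le_ofReal ?_)
  gcongr

/-- Strong law of large numbers for the empirical cdf at a point. -/
lemma ae_tendsto_empiricalCDF (hindep : iIndepFun X P) (hlaw : ∀ i, HasLaw (X i) μ P) (x : ℝ) :
    ∀ᵐ ω ∂P, Tendsto (fun n ↦ empiricalCDF X n ω x) atTop (𝓝 (cdf μ x)) := by
  have h := strong_law_ae (fun i ω ↦ (Iic x).indicator (fun _ ↦ (1 : ℝ)) (X i ω))
    ((memLp_indicator_Iic_comp hlaw x 0 1).integrable le_rfl)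
    (fun i j hij ↦ (hindep.indepFun hij).comp (measurable_indicator_Iic_one x)
      (measurable_indicator_Iic_one x))
    (fun i ↦ (identDistrib_of_hasLaw hlaw i 0).comp (measurable_indicator_Iic_one x))
  simpa only [integral_indicator_Iic_comp hlaw] using! h

/-- Strong consistency of the empirical quantile. -/
lemma ae_tendsto_quantile_empiricalCDF (hindep : iIndepFun X P) (hlaw : ∀ i, HasLaw (X i) μ P)
    {p c : ℝ} (hp : p ∈ Ioo (0 : ℝ) 1) (hlt : ∀ y < c, cdf μ y < p) (hgt : ∀ y > c, p < cdf μ y) :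
    ∀ᵐ ω ∂P, Tendsto (fun n ↦ quantile (empiricalCDF X n ω) p) atTop (𝓝 c) := by
  -- Rational points suffice to bracket `c`, and countability gives a single null set.
  have h : ∀ᵐ ω ∂P, ∀ q : ℚ, Tendsto (fun n ↦ empiricalCDF X n ω q) atTop (𝓝 (cdf μ q)) :=
    ae_all_iff.2 fun q ↦ ae_tendsto_empiricalCDF hindep hlaw q
  filter_upwards [h] with ω hω
  refine tendsto_order.2 ⟨fun a ha ↦ ?_, fun a ha ↦ ?_⟩
  · obtain ⟨q, haq, hqc⟩ := exists_rat_btwn ha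
    filter_upwards [(hω q).eventually_lt_const (hlt q hqc), eventually_ne_atTop 0] with n hn hn0
    exact haq.trans (not_le.1 fun hle ↦
      ((quantile_empiricalCDF_le_iff X hn0 ω hp q).1 hle).not_gt hn)
  · obtain ⟨q, hcq, hqa⟩ := exists_rat_btwn ha
    filter_upwards [(hω q).eventually_const_lt (hgt q hcq), eventually_ne_atTop 0] with n hn hn0
    exact ((quantile_empiricalCDF_le_iff X hn0 ω hp q).2 hn.le).trans_lt hqa

end Probability

/-! ### Asymptotic normality -/

theorem mainTheorem3 {Ω : Type*} [MeasurableSpace Ω] (P : Measure Ω) [IsProbabilityMeasure P]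
    (μ : Measure ℝ) [IsProbabilityMeasure μ] (X : ℕ → Ω → ℝ)
    (hindep : iIndepFun X P) (hlaw : ∀ i, HasLaw (X i) μ P)
    (p : ℝ) (hp : p ∈ Ioo (0 : ℝ) 1)
    (hF : IntervalIntegrable (quantile (cdf μ)) volume p 1)
    (hcont : ContinuousAt (cdf μ) (quantile (cdf μ) p))
    (hincr : StrictlyIncreasingAt (cdf μ) (quantile (cdf μ) p))
    (hvar : evariance (fun ω ↦ tailDeviation (cdf μ) p (X 0 ω)) P < ⊤) :
    TendstoInDistribution
      (fun (n : ℕ) (ω : Ω) ↦ √(n : ℝ) *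
        ((∫ u in p..1, quantile (empiricalCDF X n ω) u) - ∫ u in p..1, quantile (cdf μ) u))
      atTop (id : ℝ → ℝ) (fun _ ↦ P)
      (gaussianReal 0 (variance (fun ω ↦ tailDeviation (cdf μ) p (X 0 ω)) P).toNNReal) := by
  set c := quantile (cdf μ) p with hc
  have hcp : cdf μ c = p := cdf_quantile_eq hp hcont
  have hint := integrable_posPart_sub_quantile hp hF
  rw [← hc] at hint
  let Y : ℕ → Ω → ℝ := fun i ω ↦ max (X i ω - c) 0
  have hpos : Measurable fun x : ℝ ↦ max (x - c) 0 := by fun_prop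
  have hYident : ∀ i, IdentDistrib (Y i) (Y 0) P P := fun i ↦
    (identDistrib_of_hasLaw hlaw i 0).comp hpos
  have hYmeas : AEStronglyMeasurable (Y 0) P := (hYident 0).aemeasurable_fst.aestronglyMeasurable
  have hYmean : ∫ ω, Y 0 ω ∂P = ∫ x, max (x - c) 0 ∂μ :=
    (hlaw 0).integral_comp (f := fun x ↦ max (x - c) 0) hpos.aestronglyMeasurable
  have htail : (fun ω ↦ tailDeviation (cdf μ) p (X 0 ω)) =
      fun ω ↦ (∫ x in Ioi c, (1 - cdf μ x)) - Y 0 ω :=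
    funext fun ω ↦ tailDeviation_cdf_eq hint (X 0 ω)
  rw [htail] at hvar ⊢
  rw [variance_const_sub hYmeas]
  -- Finite variance gives the second moment that the central limit theorem needs.
  have hYLp : MemLp (Y 0) 2 P := by
    have h := (evariance_lt_top_iff_memLp (aestronglyMeasurable_const.sub hYmeas)).1 hvar
    exact ((memLp_const (∫ x in Ioi c, (1 - cdf μ x))).sub h).ae_eq
      (ae_of_all _ fun ω ↦ sub_sub_cancel _ _)
  have hCLT := tendstoInDistribution_inv_sqrt_mul_sum_sub
    (Y := (id : ℝ → ℝ)) (P' := gaussianReal 0 Var[Y 0; P].toNNReal) HasLaw.id hYLp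
    (hindep.comp _ fun _ ↦ hpos) hYident
  -- Slutsky: only the difference from the normalized sum has to vanish in probability.
  refine tendstoInDistribution_of_tendstoInMeasure_sub _ _ hCLT ?_ fun n ↦
    ((aemeasurable_integral_quantile_empiricalCDF (fun i ↦ (hlaw i).aemeasurable) hp).sub_const
      _).const_mul _
  refine tendstoInMeasure_zero_of_abs_le_mul
    (A := fun n ω ↦ √(n : ℝ) * (empiricalCDF X n ω c - cdf μ c))
    (B := fun n ω ↦ quantile (empiricalCDF X n ω) p - c) (fun η hη ↦ ?_) ?_ fun n ω ↦ ?_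
  · have hlim : Tendsto (fun M : ℝ ↦ ENNReal.ofReal (1 / M ^ 2)) atTop (𝓝 0) := by
      simpa using ENNReal.tendsto_ofReal
        ((tendsto_pow_atTop (α := ℝ) two_ne_zero).inv_tendsto_atTop)
    obtain ⟨M, hM, hM0⟩ :=
      ((ENNReal.tendsto_nhds_zero.1 hlim η hη).and (eventually_gt_atTop 0)).exists
    exact ⟨M, hM0, fun n ↦ (measure_sqrt_mul_empiricalCDF_sub_le hindep hlaw c n hM0).trans hM⟩
  · refine tendstoInMeasure_of_tendsto_ae (fun n ↦ ((aemeasurable_quantile_empiricalCDF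
      (fun i ↦ (hlaw i).aemeasurable) hp).sub_const c).aestronglyMeasurable) ?_
    filter_upwards [ae_tendsto_quantile_empiricalCDF hindep hlaw hp
      (fun y hy ↦ hcp ▸ hincr.1 y hy) (fun y hy ↦ hcp ▸ hincr.2 y hy)] with ω hω
    simpa using hω.sub_const c
  · obtain rfl | hn := eq_or_ne n 0
    · simp
    have hn0 : (0 : ℝ) < n := by positivity
    have hb := abs_integral_quantile_empiricalCDF_sub_le X hn ω hp c
    have hsq : (√(n : ℝ))⁻¹ = √n * (n : ℝ)⁻¹ := by
      field_simp
      exact (Real.sq_sqrt hn0.le).symm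
    -- The formula is exact for the true law, so the difference is √n times the empirical error
    -- alone.
    have hD : ∀ a : ℝ, √(n : ℝ) * (a - ∫ u in p..1, quantile (cdf μ) u) -
        (√(n : ℝ))⁻¹ * (∑ k ∈ Finset.range n, Y k ω - n * ∫ ω, Y 0 ω ∂P) =
        √n * (a - ((1 - p) * c + (n : ℝ)⁻¹ * ∑ i ∈ Finset.range n, max (X i ω - c) 0)) := by
      intro a
      rw [integral_quantile_eq hp hF, ← hc, hYmean, hsq]
      field_simp
      ring
    simp only [Pi.sub_apply]
    rw [hD, abs_mul, abs_mul, hcp, mul_assoc, mul_comm |empiricalCDF X n ω c - p|]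
    gcongr
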